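/- Let $\delta>0$ be real and let $p$ be a prime. There are integers $J_0=J_0(\delta,p)$ and $N=N(\delta,p)$ such that the following holds for every $n\ge N$. Let $\mathbb F=\mathbb F_{p^n}$, $F=p^n=|\mathbb F|$, and let $a\cdot m\in\mathbb F_p$ denote the dot product of $a,m\in\mathbb F$ in the coordinates of a fixed $\mathbb F_p$-basis of $\mathbb F$. For $f:\mathbb F\to[0,1]$ put $$\theta=\frac1F\sum_{a\in\mathbb F}f(a),\qquad \hat f(a)=\sum_{m\in\mathbb F}f(m)e^{2\pi i(a\cdot m)/p},\qquad \Lambda(f)=\frac1{F^{2}}\sum_{m,d\in\mathbb F}f(m)f(m+d)f(m+2d),$$ and enumerate $\mathbb F=\{a_1,\dots,a_F\}$ so that $|\hat f(a_1)|\ge|\hat f(a_2)|\ge\cdots\ge|\hat f(a_F)|$. Suppose that $\theta>F^{-1/9}$ and that $$|\hat f(a_j)|<\theta^{\,j^{1/2+\delta}}F$$ for some integer $j$ with $J_0<j<F^{1/8}$. Then $$\Lambda(f)>\theta F^{-1},$$ and the support $S=\{m\in\mathbb F: f(m)>0\}$ contains a non-trivial three-term arithmetic progression, that is, there are $m,d\in\mathbb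 F$ with $d\ne0$ and $m,\ m+d,\ m+2d\in S$. -/

import Mathlib

namespace CrootThreeAP

/-- The usual dot product on an `n`-dimensional vector space over `𝔽_p`, in the coordinates
of the basis `b`. -/
noncomputable def dot {p n : ℕ} {K : Type*} [AddCommGroup K] [Module (ZMod p) K]
    (b : Module.Basis (Fin n) (ZMod p) K) (x y : K) : ZMod p :=
  ∑ i, b.repr x i * b.repr y i

/-- The (unnormalised) Fourier coefficient `∑ m, f(m) e^{2 π i (a · m) / p}`. -/
noncomputable def fourierCoeff {p n : ℕ} {K : Type*} [AddCommGroup K] [Module (ZMod p) K]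
    [Fintype K] (b : Module.Basis (Fin n) (ZMod p) K) (f : K → ℝ) (a : K) : ℂ :=
  ∑ m, (f m : ℂ) * Complex.exp (2 * Real.pi * Complex.I * ((dot b a m).val : ℂ) / (p : ℂ))

/-- The mean `E(f) = F⁻¹ ∑ a, f(a)`, where `F = |K|`. -/
noncomputable def mean {K : Type*} [Fintype K] (f : K → ℝ) : ℝ :=
  (Fintype.card K : ℝ)⁻¹ * ∑ a, f a

/-- `Λ(f) = F⁻² ∑_{m,d} f(m) f(m+d) f(m+2d)`, where `F = |K|`. -/
noncomputable def Lam {K : Type*} [AddCommGroup K] [Fintype K] (f : K → ℝ) : ℝ :=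
  ((Fintype.card K : ℝ) ^ 2)⁻¹ * ∑ m, ∑ d, f m * f (m + d) * f (m + 2 • d)

/-- `a 1, a 2, …, a F` lists every element of `K` exactly once (`F = |K|`), in order of
non-increasing absolute value of the Fourier coefficient. -/
def IsFourierOrdering {p n : ℕ} {K : Type*} [AddCommGroup K] [Module (ZMod p) K]
    [Fintype K] (b : Module.Basis (Fin n) (ZMod p) K) (f : K → ℝ) (a : ℕ → K) : Prop :=
  Set.BijOn a (Set.Icc 1 (Fintype.card K)) Set.univ ∧
    AntitoneOn (fun i => ‖fourierCoeff b f (a i)‖) (Set.Icc 1 (Fintype.card K))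

/-- `S` contains a non-trivial three-term arithmetic progression `m, m + d, m + 2d`, `d ≠ 0`. -/
def HasNontrivialThreeAP {K : Type*} [AddCommGroup K] (S : Set K) : Prop :=
  ∃ m d : K, d ≠ 0 ∧ m ∈ S ∧ m + d ∈ S ∧ m + 2 • d ∈ S

end CrootThreeAP

/-!
Let `N = |K|`, let `L = log (1/θ)`, and let `S` be the set of the `j` frequencies with the largest
Fourier coefficients, so that all coefficients off `S` are at most `E = θ ^ (j ^ (1/2 + δ)) N`. The
count `T = ∑ f(m) f(m+d) f(m+2d)` satisfies `N T = ∑_φ f̂(φ)² f̂(-2φ)`. It is enough to show that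
`T > θ N = ∑ f`: the progressions with `d = 0` contribute only `∑ f³ ≤ ∑ f`, so one with `d ≠ 0`
must occur. Two cases are immediate: `p = 2`, where the count factors, and `θ ≥ 3/4`. Otherwise `L`
is bounded below, and there are two regimes.

*Few large coefficients*, `L j ^ (1/2 + δ) < 2 log N` (`lt_apCount_of_increment`). The nontrivial
frequencies in `S` contribute at most `j M³`, where `M` is the largest nontrivial coefficient, and
those off `S` a negligible amount. Hence either `N T ≥ (∑ f)³ / 2`, or `M` exceeds `η ∑ f` with
`η = 1 / (2 √j)`, and then `f` is denser by a factor `1 + η / 2` on some coset of a hyperplane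
(`exists_coset_sum_gt`). Restriction to the coset does not increase the unnormalised coefficients
off (the image of) `S` (`norm_hat_coset_le`), so the step can be repeated
(`cube_mul_sq_le_apCount`). Since densities are at most `1`, this stops after `O(√j L)` steps, which
costs a factor `p ^ O(√j L)`: small against both `θ² N / E` and `θ² N` when `j` is large.

*Negligible tail*, `E ≤ 1 / N` (`lt_apCount_of_tiny_tail`). Choose a large subspace `W` of the dual
space avoiding the nonzero differences of elements of `S` (`exists_submodule_disjoint`). On the
Fourier side, progressions whose difference is annihilated by `W` are, up to a negligible error, the
proportion `1 / |W|` of all progressions (`card_mul_sum_cube_le`). The former include those with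
`d = 0`, so that `T` is at least about `|W| ∑ f³`, where `|W| ≥ N / (1 + p j²)`. As `j < N ^ (1/8)`
and `θ > N ^ (-1/9)`, this exceeds `θ N`.
-/

namespace CrootThreeAP

open Finset Module ComplexConjugate

/-! ### Fourier analysis on a finite vector space over `𝔽_p` -/

section Fourier

variable {p : ℕ} [Fact p.Prime] {G : Type*} [AddCommGroup G] [Module (ZMod p) G] [Fintype G]

noncomputable instance fintypeDual : Fintype (Dual (ZMod p) G) :=
  have : Finite (Dual (ZMod p) G) := Module.finite_of_finite (ZMod p)
  Fintype.ofFinite _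

lemma card_dual : Fintype.card (Dual (ZMod p) G) = Fintype.card G := by
  rw [card_eq_pow_finrank (K := ZMod p), Subspace.dual_finrank_eq,
    ← card_eq_pow_finrank (K := ZMod p)]

/-- The unnormalised Fourier transform on `G`, the characters of `G` being indexed by the linear
functionals `φ`, with `φ` standing for `x ↦ e^{2πi φ(x)/p}`. -/
noncomputable def hat (f : G → ℂ) (φ : Dual (ZMod p) G) : ℂ :=
  ∑ x, f x * ZMod.stdAddChar (φ x)

lemma norm_stdAddChar (t : ZMod p) : ‖ZMod.stdAddChar t‖ = 1 := AddChar.norm_apply _ _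

lemma conj_stdAddChar (t : ZMod p) : conj (ZMod.stdAddChar t) = ZMod.stdAddChar (-t) := by
  rw [AddChar.map_neg_eq_inv, Complex.inv_def, Complex.normSq_eq_norm_sq, norm_stdAddChar]
  simp

omit [Fintype G] in
/-- Summing over a subspace of functionals gives `0` or the size of the subspace. -/
lemma sum_stdAddChar_submodule (W : Submodule (ZMod p) (Dual (ZMod p) G)) [Fintype W] (x : G)
    [Decidable (∀ w : W, w.1 x = 0)] :
    ∑ w : W, ZMod.stdAddChar (w.1 x) = if ∀ w : W, w.1 x = 0 then (Fintype.card W : ℂ) else 0 := by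
  classical
  let ψ : AddChar W ℂ :=
    ZMod.stdAddChar.compAddMonoidHom ((Dual.eval (ZMod p) G x ∘ₗ W.subtype).toAddMonoidHom)
  have h := AddChar.sum_eq_ite ψ
  have h0 : ψ = 0 ↔ ∀ w : W, w.1 x = 0 := by
    rw [AddChar.ext_iff]
    refine forall_congr' fun w => ?_
    change ZMod.stdAddChar (w.1 x) = 1 ↔ _
    rw [← AddChar.map_zero_eq_one (ZMod.stdAddChar (N := p)), ZMod.injective_stdAddChar.eq_iff]
  simp only [h0] at h
  exact h

lemma sum_dual_stdAddChar [DecidableEq G] (x : G) :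
    ∑ φ : Dual (ZMod p) G, ZMod.stdAddChar (φ x) = if x = 0 then (Fintype.card G : ℂ) else 0 := by
  classical
  let ψ : AddChar (Dual (ZMod p) G) ℂ :=
    ZMod.stdAddChar.compAddMonoidHom (Dual.eval (ZMod p) G x).toAddMonoidHom
  have h := AddChar.sum_eq_ite ψ
  have h0 : ψ = 0 ↔ x = 0 := by
    rw [AddChar.ext_iff, ← forall_dual_apply_eq_zero_iff (ZMod p) x]
    refine forall_congr' fun w => ?_
    change ZMod.stdAddChar (w x) = 1 ↔ _
    rw [← AddChar.map_zero_eq_one (ZMod.stdAddChar (N := p)), ZMod.injective_stdAddChar.eq_iff]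
  simp only [h0, card_dual] at h
  exact h

lemma hat_mul_stdAddChar (f : G → ℂ) (w φ : Dual (ZMod p) G) :
    hat (fun x => f x * ZMod.stdAddChar (w x)) φ = hat f (φ + w) := by
  unfold hat
  refine sum_congr rfl fun x _ => ?_
  rw [LinearMap.add_apply, AddChar.map_add_eq_mul]
  ring

lemma hat_zero (f : G → ℂ) : hat (p := p) f 0 = ∑ x, f x := by
  simp [hat]

/-- Parseval's identity. -/
lemma sum_norm_hat_sq (f : G → ℂ) :
    ∑ φ : Dual (ZMod p) G, ‖hat f φ‖ ^ 2 = Fintype.card G * ∑ x, ‖f x‖ ^ 2 := by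
  classical
  have key : ∑ φ : Dual (ZMod p) G, hat f φ * conj (hat f φ)
      = Fintype.card G * ∑ x, f x * conj (f x) := by
    have h1 : ∀ φ : Dual (ZMod p) G, hat f φ * conj (hat f φ)
        = ∑ x, ∑ y, f x * conj (f y) * ZMod.stdAddChar (φ (x - y)) := by
      intro φ
      simp only [hat, map_sum, map_mul, sum_mul_sum, conj_stdAddChar]
      refine sum_congr rfl fun x _ => sum_congr rfl fun y _ => ?_
      rw [map_sub, sub_eq_add_neg, AddChar.map_add_eq_mul]
      ring
    simp only [h1]
    rw [sum_comm, mul_sum]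
    refine sum_congr rfl fun x _ => ?_
    rw [sum_comm]
    simp only [← mul_sum, sum_dual_stdAddChar, sub_eq_zero]
    simp
    ring
  simp only [Complex.mul_conj, Complex.normSq_eq_norm_sq] at key
  exact_mod_cast key

/-- The weighted count of three-term progressions as a sum over the Fourier side. -/
lemma card_mul_sum_threeAP (f g h : G → ℂ) :
    Fintype.card G * ∑ m, ∑ d, f m * g (m + d) * h (m + 2 • d)
      = ∑ φ : Dual (ZMod p) G, hat f φ * hat g ((-2 : ZMod p) • φ) * hat h φ := by
  classical
  have h1 : ∀ φ : Dual (ZMod p) G, hat f φ * hat g ((-2 : ZMod p) • φ) * hat h φ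
      = ∑ x, ∑ y, ∑ z, f x * g y * h z * ZMod.stdAddChar (φ (x - 2 • y + z)) := by
    intro φ
    rw [hat, hat, hat, sum_mul_sum, sum_mul]
    refine sum_congr rfl fun x _ => ?_
    rw [sum_mul]
    refine sum_congr rfl fun y _ => ?_
    rw [mul_sum]
    refine sum_congr rfl fun z _ => ?_
    have : φ (x - 2 • y + z) = φ x + ((-2 : ZMod p) • φ) y + φ z := by
      simp only [map_add, map_sub, map_nsmul, LinearMap.smul_apply, smul_eq_mul, nsmul_eq_mul]
      push_cast
      ring
    rw [this, AddChar.map_add_eq_mul, AddChar.map_add_eq_mul]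
    ring
  have h2 : ∀ x y z : G, (x - 2 • y + z = 0) ↔ z = 2 • y - x := by
    intro x y z
    rw [add_comm, ← sub_neg_eq_add, sub_eq_zero, neg_sub]
  calc (Fintype.card G : ℂ) * ∑ m, ∑ d, f m * g (m + d) * h (m + 2 • d)
      = ∑ x, ∑ y, f x * g y * h (2 • y - x) * (Fintype.card G : ℂ) := by
        rw [mul_sum]
        refine sum_congr rfl fun x _ => ?_
        rw [mul_sum, ← Equiv.sum_comp (Equiv.addLeft x)
          (fun y => f x * g y * h (2 • y - x) * (Fintype.card G : ℂ))]
        refine sum_congr rfl fun d _ => ?_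
        have : 2 • (x + d) - x = x + 2 • d := by simp only [two_smul]; abel
        rw [Equiv.coe_addLeft, this]
        ring
    _ = ∑ x, ∑ y, ∑ z, ∑ φ : Dual (ZMod p) G,
          f x * g y * h z * ZMod.stdAddChar (φ (x - 2 • y + z)) := by
        refine sum_congr rfl fun x _ => sum_congr rfl fun y _ => ?_
        simp only [← mul_sum, sum_dual_stdAddChar, h2, mul_ite, mul_zero, sum_ite_eq', mem_univ,
          if_true]
    _ = ∑ φ : Dual (ZMod p) G, ∑ x, ∑ y, ∑ z,
          f x * g y * h z * ZMod.stdAddChar (φ (x - 2 • y + z)) := by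
        rw [sum_comm]
        refine Eq.trans ?_ sum_comm
        rw [sum_comm]
        refine sum_congr rfl fun x _ => ?_
        refine Eq.trans ?_ sum_comm
        refine sum_congr rfl fun y _ => ?_
        exact sum_comm
    _ = _ := sum_congr rfl fun φ _ => (h1 φ).symm

end Fourier

/-! ### Elementary bounds for the number of three-term progressions -/

/-- The unnormalised weighted count of the progressions `m, m + d, m + 2d`. -/
def apCount {G : Type*} [AddCommGroup G] [Fintype G] (f : G → ℝ) : ℝ :=
  ∑ m, ∑ d, f m * f (m + d) * f (m + 2 • d)

section Count

variable {G : Type*} [AddCommGroup G] [Fintype G]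

lemma Lam_eq (f : G → ℝ) : Lam f = apCount f / (Fintype.card G : ℝ) ^ 2 := by
  rw [Lam, apCount, div_eq_inv_mul]

/-- A weighted count exceeding the mass of the function cannot come from `d = 0` alone. -/
lemma hasNontrivialThreeAP_of_sum_lt {f : G → ℝ} (hf : ∀ m, f m ∈ Set.Icc (0 : ℝ) 1)
    (h : ∑ m, f m < apCount f) : HasNontrivialThreeAP (Function.support f) := by
  classical
  by_contra hno
  refine absurd h (not_lt.2 ?_)
  refine sum_le_sum fun m _ => ?_
  rw [sum_eq_single (0 : G)]
  · obtain ⟨h0, h1⟩ := hf m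
    simp only [add_zero, smul_zero]
    nlinarith [mul_nonneg h0 h0, mul_nonneg h0 (sub_nonneg.2 h1),
      mul_nonneg (mul_nonneg h0 h0) (sub_nonneg.2 h1)]
  · intro d _ hd
    by_contra hne
    refine hno ⟨m, d, hd, ?_, ?_, ?_⟩ <;> rw [Function.mem_support] <;> rintro h0 <;>
      simp [h0] at hne
  · simp

lemma dense_le_apCount {f : G → ℝ} (hf : ∀ m, f m ∈ Set.Icc (0 : ℝ) 1) :
    (Fintype.card G : ℝ) * (3 * ∑ m, f m) - 2 * (Fintype.card G : ℝ) ^ 2 ≤ apCount f := by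
  -- `x y z ≥ x + y + z - 2` on `[0,1]³`
  have h : ∀ m d, f m + f (m + d) + f (m + 2 • d) - 2 ≤ f m * f (m + d) * f (m + 2 • d) := by
    intro m d
    obtain ⟨a0, a1⟩ := hf m
    obtain ⟨b0, b1⟩ := hf (m + d)
    obtain ⟨c0, c1⟩ := hf (m + 2 • d)
    nlinarith [mul_nonneg (sub_nonneg.2 a1) (sub_nonneg.2 b1),
      mul_nonneg (sub_nonneg.2 (mul_le_one₀ a1 b0 b1)) (sub_nonneg.2 c1)]
  refine le_trans (le_of_eq ?_) (sum_le_sum fun m _ => sum_le_sum fun d _ => h m d)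
  have h1 : ∑ m, ∑ d, f (m + d) = Fintype.card G * ∑ m, f m := by
    have : ∀ m, ∑ d, f (m + d) = ∑ d, f d := fun m => Equiv.sum_comp (Equiv.addLeft m) f
    simp [this]
  have h2 : ∑ m, ∑ d, f (m + 2 • d) = Fintype.card G * ∑ m, f m := by
    rw [sum_comm]
    have : ∀ d : G, ∑ m, f (m + 2 • d) = ∑ d, f d := fun d => Equiv.sum_comp (Equiv.addRight (2 • d)) f
    simp [this]
  simp only [sum_sub_distrib, sum_add_distrib, h1, h2, sum_const, card_univ, nsmul_eq_mul]
  rw [← mul_sum]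
  ring

lemma cube_sum_le {G : Type*} [Fintype G] {f : G → ℝ} (hf : ∀ m, f m ∈ Set.Icc (0 : ℝ) 1) :
    (∑ m, f m) ^ 3 / (Fintype.card G : ℝ) ^ 2 ≤ ∑ m, f m ^ 3 :=
  pow_sum_div_card_le_sum_pow (s := univ) (fun i _ => (hf i).1) 2

/-- In characteristic `2` a progression is `m, m + d, m`, and the count factors. -/
lemma cube_sum_le_apCount_of_char_two (h2 : ∀ d : G, 2 • d = 0) {f : G → ℝ}
    (hf : ∀ m, f m ∈ Set.Icc (0 : ℝ) 1) :
    (∑ m, f m) ^ 3 / (Fintype.card G : ℝ) ≤ apCount f := by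
  have h : apCount f = (∑ m, f m ^ 2) * ∑ m, f m := by
    rw [apCount, sum_mul]
    refine sum_congr rfl fun m _ => ?_
    rw [← Equiv.sum_comp (Equiv.addLeft m) f, mul_sum]
    refine sum_congr rfl fun d _ => ?_
    rw [h2, add_zero, Equiv.coe_addLeft]
    ring
  have h3 : (∑ m, f m) ^ 2 / (Fintype.card G : ℝ) ^ 1 ≤ ∑ m, f m ^ 2 :=
    pow_sum_div_card_le_sum_pow (s := univ) (fun i _ => (hf i).1) 1
  have h4 := mul_le_mul_of_nonneg_right h3 (sum_nonneg fun i (_ : i ∈ univ) => (hf i).1)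
  rw [h]
  refine le_trans (le_of_eq ?_) h4
  rw [pow_one]
  ring

end Count

/-! ### The density increment argument -/

section Increment

variable {p : ℕ} [Fact p.Prime] {G : Type*} [AddCommGroup G] [Module (ZMod p) G] [Fintype G]

lemma sum_norm_sq_le {f : G → ℝ} (hf : ∀ m, f m ∈ Set.Icc (0 : ℝ) 1) :
    ∑ φ : Dual (ZMod p) G, ‖hat (fun x => (f x : ℂ)) φ‖ ^ 2 ≤ Fintype.card G * ∑ m, f m := by
  rw [sum_norm_hat_sq]
  refine mul_le_mul_of_nonneg_left (sum_le_sum fun x _ => ?_) (Nat.cast_nonneg _)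
  obtain ⟨h0, h1⟩ := hf x
  rw [Complex.norm_real, Real.norm_eq_abs, sq_abs]
  nlinarith

lemma sum_norm_hat_mul_le {f : G → ℝ} (hf : ∀ m, f m ∈ Set.Icc (0 : ℝ) 1)
    {σ τ : Dual (ZMod p) G → Dual (ZMod p) G} (hσ : Function.Injective σ)
    (hτ : Function.Injective τ) :
    ∑ φ, ‖hat (fun x => (f x : ℂ)) (σ φ)‖ * ‖hat (fun x => (f x : ℂ)) (τ φ)‖
      ≤ Fintype.card G * ∑ m, f m := by
  have h : ∀ {σ : Dual (ZMod p) G → Dual (ZMod p) G}, Function.Injective σ →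
      ∑ φ, ‖hat (fun x => (f x : ℂ)) (σ φ)‖ ^ 2 ≤ Fintype.card G * ∑ m, f m := fun {σ} hs =>
    ((Finite.injective_iff_bijective.1 hs).sum_comp
      fun φ => ‖hat (fun x => (f x : ℂ)) φ‖ ^ 2).trans_le (sum_norm_sq_le hf)
  have h2 : ∑ φ, ‖hat (fun x => (f x : ℂ)) (σ φ)‖ * ‖hat (fun x => (f x : ℂ)) (τ φ)‖
      ≤ ∑ φ, (‖hat (fun x => (f x : ℂ)) (σ φ)‖ ^ 2 + ‖hat (fun x => (f x : ℂ)) (τ φ)‖ ^ 2) / 2 :=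
    sum_le_sum fun φ _ => by
      nlinarith [sq_nonneg (‖hat (fun x => (f x : ℂ)) (σ φ)‖ - ‖hat (fun x => (f x : ℂ)) (τ φ)‖)]
  rw [← sum_div, sum_add_distrib] at h2
  linarith [h hσ, h hτ]

lemma neg_two_ne_zero (hp2 : p ≠ 2) : (-2 : ZMod p) ≠ 0 := by
  rw [neg_ne_zero]
  intro h
  have h1 : ((2 : ℕ) : ZMod p) = 0 := by exact_mod_cast h
  rw [ZMod.natCast_eq_zero_iff] at h1
  exact hp2 ((Nat.prime_dvd_prime_iff_eq (Fact.out) Nat.prime_two).1 h1)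

/-- If all nontrivial Fourier coefficients are at most `M`, and at most `E` off the set `S`,
then the count of progressions is close to its expected value. -/
lemma cube_sub_le_card_mul_apCount (hp2 : p ≠ 2) {f : G → ℝ}
    (hf : ∀ m, f m ∈ Set.Icc (0 : ℝ) 1) {S : Finset (Dual (ZMod p) G)} {E M : ℝ} (hE0 : 0 ≤ E)
    (hM0 : 0 ≤ M) (hE : ∀ φ ∉ S, ‖hat (fun x => (f x : ℂ)) φ‖ ≤ E)
    (hM : ∀ φ : Dual (ZMod p) G, φ ≠ 0 → ‖hat (fun x => (f x : ℂ)) φ‖ ≤ M) :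
    (∑ m, f m) ^ 3 - #S * M ^ 3 - E * (Fintype.card G * ∑ m, f m)
      ≤ Fintype.card G * apCount f := by
  classical
  set F : G → ℂ := fun x => (f x : ℂ) with hF
  have hid := card_mul_sum_threeAP (p := p) F F F
  have h2 : (-2 : ZMod p) ≠ 0 := neg_two_ne_zero hp2
  rw [← add_sum_erase _ _ (mem_univ (0 : Dual (ZMod p) G)), smul_zero, hat_zero] at hid
  have hbound : ‖∑ φ ∈ univ.erase (0 : Dual (ZMod p) G),
      hat F φ * hat F ((-2 : ZMod p) • φ) * hat F φ‖
        ≤ #S * M ^ 3 + E * (Fintype.card G * ∑ m, f m) := by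
    calc _ ≤ ∑ φ ∈ univ.erase (0 : Dual (ZMod p) G),
            ((if φ ∈ S then M ^ 3 else 0) + E * (‖hat F φ‖ * ‖hat F ((-2 : ZMod p) • φ)‖)) := by
          refine norm_sum_le_of_le _ fun φ hφ => ?_
          rw [norm_mul, norm_mul]
          have hφ0 : φ ≠ 0 := ne_of_mem_erase hφ
          have hφ2 : (-2 : ZMod p) • φ ≠ 0 := smul_ne_zero h2 hφ0
          split_ifs with hS
          · calc _ ≤ M * M * M := by
                  gcongr
                  exacts [hM _ hφ0, hM _ hφ2, hM _ hφ0]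
              _ = M ^ 3 + 0 := by ring
              _ ≤ _ := by gcongr; positivity
          · rw [zero_add, mul_comm]
            gcongr
            exact hE _ hS
      _ ≤ ∑ φ : Dual (ZMod p) G,
            ((if φ ∈ S then M ^ 3 else 0) + E * (‖hat F φ‖ * ‖hat F ((-2 : ZMod p) • φ)‖)) := by
          refine sum_le_sum_of_subset_of_nonneg (erase_subset _ _) fun φ _ _ => ?_
          split_ifs <;> positivity
      _ = #S * M ^ 3 + E * ∑ φ, ‖hat F φ‖ * ‖hat F ((-2 : ZMod p) • φ)‖ := by
          rw [sum_add_distrib, ← mul_sum, sum_ite_mem, univ_inter, sum_const, nsmul_eq_mul]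
      _ ≤ _ := by
          gcongr
          exact sum_norm_hat_mul_le hf Function.injective_id (smul_right_injective _ h2)
  have hre := congrArg Complex.re hid
  have e1 : ((Fintype.card G : ℂ) * ∑ m, ∑ d, F m * F (m + d) * F (m + 2 • d)).re
      = Fintype.card G * apCount f := by
    rw [apCount, ← Complex.ofReal_re (Fintype.card G * _)]
    push_cast
    rfl
  have e2 : ((∑ x, F x) * (∑ x, F x) * ∑ x, F x).re = (∑ m, f m) ^ 3 := by
    rw [← Complex.ofReal_re ((∑ m, f m) ^ 3)]
    push_cast
    rw [pow_three, mul_assoc]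
  rw [Complex.add_re, e1, e2] at hre
  have := (Complex.abs_re_le_norm _).trans hbound
  rw [abs_le] at this
  linarith [this.1]

lemma sum_comp_le_sum_of_injective {α β : Type*} [Fintype α] [Fintype β] {i : α → β}
    (hi : Function.Injective i) {h : β → ℝ} (h0 : ∀ x, 0 ≤ h x) :
    ∑ x, h (i x) ≤ ∑ y, h y := by
  classical
  rw [← sum_image (s := univ) (g := i) (f := h) hi.injOn]
  exact sum_le_sum_of_subset_of_nonneg (subset_univ _) fun y _ _ => h0 y

lemma apCount_coset_le {f : G → ℝ} (hf : ∀ m, 0 ≤ f m) (H : Submodule (ZMod p) G) [Fintype H]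
    (c : G) : apCount (fun x : H => f (c + x)) ≤ apCount f := by
  unfold apCount
  refine le_trans (sum_le_sum fun m _ => ?_)
    (sum_comp_le_sum_of_injective (i := fun x : H => c + (x : G))
      (fun x y h => Subtype.ext (add_left_cancel h))
      (h := fun m => ∑ d, f m * f (m + d) * f (m + 2 • d))
      fun m => sum_nonneg fun d _ => mul_nonneg (mul_nonneg (hf _) (hf _)) (hf _))
  refine le_trans (le_of_eq ?_)
    (sum_comp_le_sum_of_injective (i := fun x : H => (x : G)) Subtype.val_injective
      (h := fun d => f (c + m) * f (c + m + d) * f (c + m + 2 • d))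
      fun d => mul_nonneg (mul_nonneg (hf _) (hf _)) (hf _))
  refine sum_congr rfl fun d _ => ?_
  simp only [Submodule.coe_add, Submodule.coe_smul_of_tower, add_assoc]

omit [Fintype G] in
lemma card_ker_mul [Finite G] {φ : Dual (ZMod p) G} (hφ : φ ≠ 0) :
    Nat.card φ.ker * p = Nat.card G := by
  rw [Submodule.card_eq_card_quotient_mul_card φ.ker,
    Nat.card_congr (φ.quotKerEquivOfSurjective (LinearMap.surjective hφ)).toEquiv, Nat.card_zmod]

/-- Averaging over the multiples of `φ` detects the hyperplane `ker φ`. -/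
lemma mul_sum_ker (φ : Dual (ZMod p) G) [Fintype φ.ker] (F : G → ℂ) :
    (p : ℂ) * ∑ x : φ.ker, F x = ∑ i : ZMod p, ∑ x, F x * ZMod.stdAddChar ((i • φ) x) := by
  classical
  rw [sum_comm]
  have h : ∀ x, ∑ i : ZMod p, F x * ZMod.stdAddChar ((i • φ) x)
      = if φ x = 0 then (p : ℂ) * F x else 0 := by
    intro x
    simp only [LinearMap.smul_apply, smul_eq_mul]
    rw [← mul_sum, AddChar.sum_mulShift _ (ZMod.isPrimitive_stdAddChar p), ZMod.card]
    split_ifs <;> simp [mul_comm]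
  simp only [h]
  rw [← sum_filter, mul_sum]
  refine (sum_subtype _ (fun x => ?_) (fun x => (p : ℂ) * F x)).symm
  rw [mem_filter, LinearMap.mem_ker]
  simp

/-- The unnormalised Fourier coefficients of the restriction to a coset of a hyperplane are
averages of those of the original function, over the extensions of the functional. -/
lemma norm_hat_coset_le {f : G → ℝ} {S : Finset (Dual (ZMod p) G)} {E : ℝ}
    (hE : ∀ φ ∉ S, ‖hat (fun x => (f x : ℂ)) φ‖ ≤ E) (φ : Dual (ZMod p) G) [Fintype φ.ker]
    (c : G) {ψ : Dual (ZMod p) φ.ker} (hψ : ∀ χ ∈ S, χ ∘ₗ φ.ker.subtype ≠ ψ) :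
    ‖hat (fun x : φ.ker => (f (c + x) : ℂ)) ψ‖ ≤ E := by
  obtain ⟨χ, hχ⟩ := LinearMap.exists_extend ψ
  have hp0 : (0 : ℝ) < p := Nat.cast_pos.2 (Fact.out : p.Prime).pos
  have h1 : (p : ℂ) * hat (fun x : φ.ker => (f (c + x) : ℂ)) ψ
      = ∑ i : ZMod p, ZMod.stdAddChar (-(χ + i • φ) c) * hat (fun x => (f x : ℂ)) (χ + i • φ) := by
    have h2 : hat (fun x : φ.ker => (f (c + x) : ℂ)) ψ
        = ∑ x : φ.ker, (fun x : G => (f (c + x) : ℂ) * ZMod.stdAddChar (χ x)) x := by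
      rw [hat]
      refine sum_congr rfl fun x _ => ?_
      rw [← hχ]
      rfl
    rw [h2]
    refine (mul_sum_ker φ (fun x : G => (f (c + x) : ℂ) * ZMod.stdAddChar (χ x))).trans ?_
    refine sum_congr rfl fun i _ => ?_
    rw [hat, mul_sum, ← Equiv.sum_comp (Equiv.addLeft c) fun x =>
      ZMod.stdAddChar (-(χ + i • φ) c) * ((f x : ℂ) * ZMod.stdAddChar ((χ + i • φ) x))]
    refine sum_congr rfl fun x _ => ?_
    rw [Equiv.coe_addLeft, map_add, AddChar.map_add_eq_mul, LinearMap.add_apply _ _ x,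
      AddChar.map_add_eq_mul _ (χ x), AddChar.map_neg_eq_inv]
    have : ZMod.stdAddChar ((χ + i • φ) c) ≠ 0 := by
      rw [← norm_ne_zero_iff, norm_stdAddChar]
      exact one_ne_zero
    field_simp
  have h3 : (p : ℝ) * ‖hat (fun x : φ.ker => (f (c + x) : ℂ)) ψ‖ ≤ p * E := by
    have h4 : ‖(p : ℂ) * hat (fun x : φ.ker => (f (c + x) : ℂ)) ψ‖ ≤ ∑ _i : ZMod p, E := by
      rw [h1]
      refine norm_sum_le_of_le _ fun i _ => ?_
      rw [norm_mul, norm_stdAddChar, one_mul]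
      refine hE _ fun hmem => hψ _ hmem ?_
      rw [← hχ]
      ext x
      have hx : φ x = 0 := x.2
      simp [hx]
    simpa [ZMod.card] using h4
  exact le_of_mul_le_mul_left h3 hp0

/-- A large Fourier coefficient yields a coset of a hyperplane on which `f` is denser. -/
lemma exists_coset_sum_gt {f : G → ℝ} {φ : Dual (ZMod p) G} [Fintype φ.ker] (hφ : φ ≠ 0) {B : ℝ}
    (hB0 : 0 ≤ B) (hB : B < ‖hat (fun x => (f x : ℂ)) φ‖) :
    ∃ c : G, ∑ m, f m + B / 2 < p * ∑ x : φ.ker, f (c + x) := by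
  classical
  have hp0 : (0 : ℝ) < p := Nat.cast_pos.2 (Fact.out : p.Prime).pos
  obtain ⟨c, hc⟩ : ∃ c : ZMod p → G, ∀ t, φ (c t) = t :=
    ⟨_, Function.surjInv_eq (LinearMap.surjective hφ)⟩
  set s : ZMod p → ℝ := fun t => ∑ x : φ.ker, f (c t + x) with hs
  -- fibrewise summation over the cosets `c t + ker φ`
  have hfib : ∀ F : G → ℂ, ∑ x, F x = ∑ t, ∑ x : φ.ker, F (c t + x) := by
    intro F
    rw [← sum_fiberwise_of_maps_to (s := univ) (t := univ) (g := φ) (fun _ _ => mem_univ _)]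
    refine sum_congr rfl fun t _ => ?_
    refine (sum_bij (fun (x : φ.ker) _ => c t + (x : G)) ?_ ?_ ?_ ?_).symm
    · intro x _
      have hx : φ x = 0 := x.2
      simp [hx, hc]
    · intro x _ y _ h
      exact Subtype.ext (add_left_cancel h)
    · intro y hy
      have hy : φ y = t := (mem_filter.1 hy).2
      refine ⟨⟨y - c t, ?_⟩, mem_univ _, by simp⟩
      rw [LinearMap.mem_ker, map_sub, hy, hc, sub_self]
    · intros; rfl
  have hsum : ∑ t, s t = ∑ m, f m := by
    have := hfib fun x => (f x : ℂ)
    rw [hs]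
    exact_mod_cast this.symm
  have hhat : hat (fun x => (f x : ℂ)) φ
      = ∑ t, ((s t - (∑ m, f m) / p : ℝ) : ℂ) * ZMod.stdAddChar t := by
    have h0 : ∑ t : ZMod p, ZMod.stdAddChar t = 0 := by
      have := AddChar.sum_mulShift (1 : ZMod p) (ZMod.isPrimitive_stdAddChar p)
      simpa using this
    have h1 : ∀ t : ZMod p, ((s t - (∑ m, f m) / p : ℝ) : ℂ) * ZMod.stdAddChar t
        = (s t : ℂ) * ZMod.stdAddChar t - (((∑ m, f m) / p : ℝ) : ℂ) * ZMod.stdAddChar t := by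
      intro t
      push_cast
      ring
    simp only [h1, sum_sub_distrib]
    rw [← mul_sum, h0, mul_zero, sub_zero, hat, hfib]
    refine sum_congr rfl fun t _ => ?_
    rw [hs]
    push_cast
    rw [sum_mul]
    refine sum_congr rfl fun x _ => ?_
    have hx : φ x = 0 := x.2
    rw [map_add, hc, hx, add_zero]
  -- the deviations sum to zero, so half of their total size is excess
  have hdev : ∑ t, (s t - (∑ m, f m) / p) = 0 := by
    rw [sum_sub_distrib, hsum, sum_const, card_univ, ZMod.card, nsmul_eq_mul]
    field_simp
    ring
  have hlt : ∑ _t : ZMod p, B / p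
      < ∑ t, (|s t - (∑ m, f m) / p| + (s t - (∑ m, f m) / p)) := by
    rw [sum_add_distrib, hdev, add_zero, sum_const, card_univ, ZMod.card, nsmul_eq_mul]
    have : (p : ℝ) * (B / p) = B := by field_simp
    rw [this]
    refine hB.trans_le ?_
    rw [hhat]
    refine norm_sum_le_of_le _ fun t _ => ?_
    rw [norm_mul, norm_stdAddChar, mul_one, Complex.norm_real, Real.norm_eq_abs]
  obtain ⟨t, -, ht⟩ := exists_lt_of_sum_lt hlt
  refine ⟨c t, ?_⟩
  change ∑ m, f m + B / 2 < p * s t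
  have hpos : 0 < s t - (∑ m, f m) / p := by
    by_contra hneg
    rw [abs_of_nonpos (not_lt.1 hneg), neg_add_cancel] at ht
    exact absurd ht (not_lt.2 (div_nonneg hB0 hp0.le))
  rw [abs_of_pos hpos, div_lt_iff₀ hp0] at ht
  have : (∑ m, f m) / p * p = ∑ m, f m := by field_simp
  nlinarith

end Increment

/-- The density increment iteration. If at most `j` Fourier coefficients exceed `E`, then each
step either finds the expected number of progressions or passes to a coset of a hyperplane on
which the density is larger by the factor `1 + η / 2`. The density never exceeds `1`, so fewer than
`k` steps are taken. -/
theorem cube_mul_sq_le_apCount {p : ℕ} [Fact p.Prime] (hp2 : p ≠ 2) {θ₀ η E : ℝ} {j : ℕ}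
    (hθ₀ : 0 < θ₀) (hη0 : 0 ≤ η) (hη : j * η ^ 3 ≤ 1 / 4) (hE0 : 0 ≤ E) (k : ℕ) :
    ∀ {G : Type*} [AddCommGroup G] [Module (ZMod p) G] [Fintype G] {f : G → ℝ}
      (_ : ∀ m, f m ∈ Set.Icc (0 : ℝ) 1) {S : Finset (Dual (ZMod p) G)} (_ : #S ≤ j)
      (_ : ∀ φ ∉ S, ‖hat (fun x => (f x : ℂ)) φ‖ ≤ E)
      (_ : θ₀ * (Fintype.card G : ℝ) ≤ ∑ m, f m)
      (_ : (Fintype.card G : ℝ) < (1 + η / 2) ^ k * ∑ m, f m)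
      (_ : 4 * E * p ^ k ≤ θ₀ ^ 2 * (Fintype.card G : ℝ)),
      θ₀ ^ 3 * (Fintype.card G : ℝ) ^ 2 ≤ 2 * p ^ (2 * k) * apCount f := by
  have hp0 : (0 : ℝ) < p := Nat.cast_pos.2 (Fact.out : p.Prime).pos
  have hp1 : (1 : ℝ) ≤ p := Nat.one_le_cast.2 (Fact.out : p.Prime).one_le
  induction k with
  | zero =>
    intro G _ _ _ f hf S _ _ _ hk _
    have : ∑ m, f m ≤ ∑ _m : G, (1 : ℝ) := sum_le_sum fun m _ => (hf m).2
    simp at this hk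
    linarith
  | succ k ih =>
    intro G _ _ _ f hf S hS hE hθ hk hEk
    classical
    set N : ℝ := (Fintype.card G : ℝ) with hN
    have hN0 : 0 < N := Nat.cast_pos.2 Fintype.card_pos
    have hs0 : 0 < ∑ m, f m := (mul_pos hθ₀ hN0).trans_le hθ
    by_cases hbig : ∀ φ : Dual (ZMod p) G, φ ≠ 0 →
        ‖hat (fun x => (f x : ℂ)) φ‖ ≤ η * ∑ m, f m
    · have h1 := cube_sub_le_card_mul_apCount hp2 hf hE0 (by positivity) hE hbig
      rw [← hN] at h1
      set s := ∑ m, f m with hs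
      have h2 : #S * (η * s) ^ 3 ≤ s ^ 3 / 4 := by
        calc (#S : ℝ) * (η * s) ^ 3 ≤ j * (η * s) ^ 3 := by gcongr
          _ = j * η ^ 3 * s ^ 3 := by ring
          _ ≤ 1 / 4 * s ^ 3 := by gcongr
          _ = _ := by ring
      have h3 : 4 * E ≤ θ₀ ^ 2 * N :=
        le_trans (le_mul_of_one_le_right (by positivity) (one_le_pow₀ hp1)) hEk
      have h4 : E * (N * s) ≤ s ^ 3 / 4 := by
        have : (θ₀ * N) ^ 2 ≤ s ^ 2 := by gcongr
        calc E * (N * s) = 4 * E * (N * s) / 4 := by ring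
          _ ≤ θ₀ ^ 2 * N * (N * s) / 4 := by gcongr
          _ = (θ₀ * N) ^ 2 * s / 4 := by ring
          _ ≤ s ^ 2 * s / 4 := by gcongr
          _ = _ := by ring
      have h5 : (θ₀ * N) ^ 3 ≤ s ^ 3 := by gcongr
      have h6 : θ₀ ^ 3 * N ^ 2 ≤ 2 * apCount f := by
        refine le_of_mul_le_mul_left ?_ hN0
        linarith
      have h7 : 0 ≤ apCount f :=
        sum_nonneg fun m _ => sum_nonneg fun d _ =>
          mul_nonneg (mul_nonneg (hf _).1 (hf _).1) (hf _).1
      refine h6.trans ?_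
      rw [mul_assoc]
      gcongr
      exact le_mul_of_one_le_left h7 (one_le_pow₀ hp1)
    · push Not at hbig
      obtain ⟨φ, hφ, hlarge⟩ := hbig
      have : Fintype φ.ker := Fintype.ofFinite _
      obtain ⟨c, hc⟩ := exists_coset_sum_gt hφ (by positivity) hlarge
      have hcard : (Fintype.card φ.ker : ℝ) * p = N := by
        rw [hN]
        have := card_ker_mul hφ
        rw [Nat.card_eq_fintype_card, Nat.card_eq_fintype_card] at this
        exact_mod_cast this
      set N' : ℝ := (Fintype.card φ.ker : ℝ) with hN'
      set s := ∑ m, f m with hs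
      set s' := ∑ x : φ.ker, f (c + x) with hs'
      have hss : s * (1 + η / 2) ≤ p * s' := by linarith
      have hIH := ih (f := fun x : φ.ker => f (c + x)) (fun x => hf _)
        (S := S.image fun χ => χ ∘ₗ φ.ker.subtype) (card_image_le.trans hS)
        (fun ψ hψ => norm_hat_coset_le hE φ c fun χ hχ h => hψ (mem_image.2 ⟨χ, hχ, h⟩))
        (by
          refine le_of_mul_le_mul_left ?_ hp0
          have : 0 ≤ s * (η / 2) := by positivity
          calc (p : ℝ) * (θ₀ * N') = θ₀ * N := by rw [← hcard]; ring
            _ ≤ p * s' := by linarith)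
        (by
          refine lt_of_mul_lt_mul_left ?_ hp0.le
          calc (p : ℝ) * N' = N := by rw [← hcard]; ring
            _ < (1 + η / 2) ^ (k + 1) * s := hk
            _ = (1 + η / 2) ^ k * (s * (1 + η / 2)) := by ring
            _ ≤ (1 + η / 2) ^ k * (p * s') := by gcongr
            _ = p * ((1 + η / 2) ^ k * s') := by ring)
        (by
          refine le_of_mul_le_mul_left ?_ hp0
          calc (p : ℝ) * (4 * E * p ^ k) = 4 * E * p ^ (k + 1) := by ring
            _ ≤ θ₀ ^ 2 * N := hEk
            _ = p * (θ₀ ^ 2 * N') := by rw [← hcard]; ring)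
      calc θ₀ ^ 3 * N ^ 2 = p ^ 2 * (θ₀ ^ 3 * N' ^ 2) := by rw [← hcard]; ring
        _ ≤ p ^ 2 * (2 * p ^ (2 * k) * apCount fun x : φ.ker => f (c + x)) := by gcongr
        _ ≤ p ^ 2 * (2 * p ^ (2 * k) * apCount f) := by
            gcongr
            exact apCount_coset_le (fun m => (hf m).1) φ.ker c
        _ = _ := by ring

/-! ### Progressions with difference in a subspace -/

section Subspace

variable {p : ℕ} [Fact p.Prime] {G : Type*} [AddCommGroup G] [Module (ZMod p) G] [Fintype G]

/-- A set of `k` nonzero functionals is avoided by a subspace of index at most `1 + p k`: for a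
maximal avoiding subspace `W`, the translates of `W` by multiples of elements of `D` cover the
complement of `W`. -/
lemma exists_submodule_disjoint {D : Finset (Dual (ZMod p) G)} (hD : 0 ∉ D) :
    ∃ W : Submodule (ZMod p) (Dual (ZMod p) G), (∀ w ∈ W, w ∉ D) ∧
      Fintype.card G ≤ Nat.card W * (1 + p * #D) := by
  classical
  obtain ⟨W, hW, hmax⟩ := WellFounded.has_min
    (wellFounded_gt (α := Submodule (ZMod p) (Dual (ZMod p) G))) {W | ∀ w ∈ W, w ∉ D}
    ⟨⊥, fun w hw => by rwa [(Submodule.mem_bot _).1 hw]⟩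
  refine ⟨W, hW, ?_⟩
  have : Fintype W := Fintype.ofFinite _
  rw [← card_dual (p := p), Nat.card_eq_fintype_card, ← card_univ]
  have hcover : (univ : Finset (Dual (ZMod p) G)) ⊆
      univ.image (fun w : W => w.1) ∪
        ((univ : Finset W) ×ˢ (univ : Finset (ZMod p)) ×ˢ D).image
          fun x => x.1.1 + x.2.1 • x.2.2 := by
    intro φ _
    rw [mem_union]
    by_cases hφ : φ ∈ W
    · exact Or.inl (mem_image.2 ⟨⟨φ, hφ⟩, mem_univ _, rfl⟩)
    right
    have hlt : W < W ⊔ Submodule.span (ZMod p) {φ} := by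
      refine lt_of_le_of_ne le_sup_left fun h => hφ ?_
      rw [h]
      exact Submodule.mem_sup_right (Submodule.mem_span_singleton_self φ)
    have hnot : ¬ ∀ w ∈ W ⊔ Submodule.span (ZMod p) {φ}, w ∉ D := fun h => hmax _ h hlt
    push Not at hnot
    obtain ⟨d, hd, hdD⟩ := hnot
    obtain ⟨w, hw, y, hy, rfl⟩ := Submodule.mem_sup.1 hd
    obtain ⟨c, rfl⟩ := Submodule.mem_span_singleton.1 hy
    have hc : c ≠ 0 := by
      rintro rfl
      rw [zero_smul, add_zero] at hdD
      exact hW w hw hdD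
    refine mem_image.2 ⟨(⟨-(c⁻¹ • w), W.neg_mem (W.smul_mem _ hw)⟩, c⁻¹, w + c • φ),
      by simpa using hdD, ?_⟩
    simp only [smul_add, smul_smul, inv_mul_cancel₀ hc, one_smul]
    abel
  refine (card_le_card hcover).trans ((card_union_le _ _).trans ?_)
  refine (add_le_add card_image_le card_image_le).trans (le_of_eq ?_)
  rw [card_product, card_product, card_univ, card_univ, ZMod.card]
  ring

/-- Counting progressions `m, m + d, m + 2d` with the weight `e(w(d))`. If `φ` and `φ - w` never
both lie in the large spectrum `S`, this weighted count is negligible. -/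
lemma norm_twisted_count_le (hp2 : p ≠ 2) {f : G → ℝ} (hf : ∀ m, f m ∈ Set.Icc (0 : ℝ) 1)
    {S : Finset (Dual (ZMod p) G)} {E : ℝ} (hE0 : 0 ≤ E)
    (hE : ∀ φ ∉ S, ‖hat (fun x => (f x : ℂ)) φ‖ ≤ E) {w : Dual (ZMod p) G}
    (hw : ∀ φ ∈ S, φ - w ∉ S) :
    ‖∑ m, ∑ d, (f m : ℂ) * f (m + d) * f (m + 2 • d) * ZMod.stdAddChar (w d)‖
      ≤ 2 * E * ∑ m, f m := by
  set F : G → ℂ := fun x => (f x : ℂ) with hF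
  have h2 : (-2 : ZMod p) ≠ 0 := neg_two_ne_zero hp2
  have hN : (0 : ℝ) < Fintype.card G := Nat.cast_pos.2 Fintype.card_pos
  -- `e(w(d)) = e(-w(m)) e(w(m + d))`
  have hid := card_mul_sum_threeAP (p := p) (fun x => F x * ZMod.stdAddChar ((-w) x))
    (fun x => F x * ZMod.stdAddChar (w x)) F
  simp only [hat_mul_stdAddChar] at hid
  have hsplit : ∀ m d, F m * ZMod.stdAddChar ((-w) m) *
      (F (m + d) * ZMod.stdAddChar (w (m + d))) * F (m + 2 • d)
        = (f m : ℂ) * f (m + d) * f (m + 2 • d) * ZMod.stdAddChar (w d) := by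
    intro m d
    have : w d = (-w) m + w (m + d) := by simp
    rw [this, AddChar.map_add_eq_mul]
    ring
  simp only [hsplit] at hid
  refine le_of_mul_le_mul_left ?_ hN
  calc _ = ‖∑ φ : Dual (ZMod p) G,
          hat F (φ + -w) * hat F ((-2 : ZMod p) • φ + w) * hat F φ‖ := by
        rw [← hid, norm_mul, Complex.norm_natCast]
    _ ≤ ∑ φ : Dual (ZMod p) G, (E * (‖hat F ((-2 : ZMod p) • φ + w)‖ * ‖hat F φ‖)
          + E * (‖hat F ((-2 : ZMod p) • φ + w)‖ * ‖hat F (φ + -w)‖)) := by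
        refine norm_sum_le_of_le _ fun φ _ => ?_
        rw [norm_mul, norm_mul]
        by_cases hφ : φ ∈ S
        · refine le_trans ?_ (le_add_of_nonneg_right (by positivity))
          rw [mul_assoc]
          gcongr
          exact hE _ (by rw [← sub_eq_add_neg]; exact hw φ hφ)
        · refine le_trans ?_ (le_add_of_nonneg_left (by positivity))
          rw [mul_comm, mul_comm ‖hat F (φ + -w)‖]
          gcongr
          exact hE _ hφ
    _ ≤ _ := by
        have hi : Function.Injective fun φ : Dual (ZMod p) G => (-2 : ZMod p) • φ + w :=
          fun a b h => smul_right_injective _ h2 (add_right_cancel h)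
        have h3 := sum_norm_hat_mul_le hf hi Function.injective_id
        have h4 := sum_norm_hat_mul_le hf hi (add_left_injective (-w))
        rw [sum_add_distrib, ← mul_sum, ← mul_sum]
        calc _ ≤ E * (Fintype.card G * ∑ m, f m) + E * (Fintype.card G * ∑ m, f m) :=
              add_le_add (mul_le_mul_of_nonneg_left h3 hE0) (mul_le_mul_of_nonneg_left h4 hE0)
          _ = _ := by ring

/-- If distinct elements of the large spectrum are distinct modulo `W`, then the progressions whose
difference is annihilated by `W` make up, up to a negligible error, the proportion `1 / |W|` of all
progressions; among them are those with `d = 0`. -/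
theorem card_mul_sum_cube_le (hp2 : p ≠ 2) {f : G → ℝ} (hf : ∀ m, f m ∈ Set.Icc (0 : ℝ) 1)
    {S : Finset (Dual (ZMod p) G)} {E : ℝ} (hE0 : 0 ≤ E)
    (hE : ∀ φ ∉ S, ‖hat (fun x => (f x : ℂ)) φ‖ ≤ E)
    {W : Submodule (ZMod p) (Dual (ZMod p) G)} (hW : ∀ φ ∈ S, ∀ χ ∈ S, φ - χ ∈ W → φ = χ) :
    (Nat.card W : ℝ) * ∑ m, f m ^ 3 ≤ apCount f + Nat.card W * (2 * E * ∑ m, f m) := by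
  classical
  have : Fintype W := Fintype.ofFinite _
  rw [Nat.card_eq_fintype_card]
  have hs0 : 0 ≤ ∑ m, f m := sum_nonneg fun m _ => (hf m).1
  let u : G → ℝ := fun d => if ∀ w : W, w.1 d = 0 then Fintype.card W else 0
  have hu : ∀ d, (u d : ℂ) = ∑ w : W, ZMod.stdAddChar (w.1 d) := by
    intro d
    rw [sum_stdAddChar_submodule]
    simp only [u]
    split_ifs <;> simp
  have hpos : ∀ m d, 0 ≤ f m * f (m + d) * f (m + 2 • d) * u d := by
    intro m d
    refine mul_nonneg (mul_nonneg (mul_nonneg (hf _).1 (hf _).1) (hf _).1) ?_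
    simp only [u]
    split_ifs <;> positivity
  have hlow : (Fintype.card W : ℝ) * ∑ m, f m ^ 3
      ≤ ∑ m, ∑ d, f m * f (m + d) * f (m + 2 • d) * u d := by
    rw [mul_sum]
    refine sum_le_sum fun m _ => ?_
    refine le_trans (le_of_eq ?_) (single_le_sum (fun d _ => hpos m d) (mem_univ (0 : G)))
    simp [u]
    ring
  have hexp : ((∑ m, ∑ d, f m * f (m + d) * f (m + 2 • d) * u d : ℝ) : ℂ)
      = ∑ w : W, ∑ m, ∑ d, (f m : ℂ) * f (m + d) * f (m + 2 • d) * ZMod.stdAddChar (w.1 d) := by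
    push_cast
    simp only [hu, mul_sum]
    exact Eq.trans (sum_congr rfl fun m _ => sum_comm) sum_comm
  have htail : ‖∑ w ∈ univ.erase (0 : W), ∑ m, ∑ d,
      (f m : ℂ) * f (m + d) * f (m + 2 • d) * ZMod.stdAddChar (w.1 d)‖
        ≤ Fintype.card W * (2 * E * ∑ m, f m) := by
    calc _ ≤ ∑ _w ∈ univ.erase (0 : W), 2 * E * ∑ m, f m := by
          refine norm_sum_le_of_le _ fun w hw => norm_twisted_count_le hp2 hf hE0 hE ?_
          intro φ hφ hφw
          refine ne_of_mem_erase hw (Subtype.ext ?_)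
          have := hW φ hφ _ hφw (by simp)
          rwa [eq_comm, sub_eq_self] at this
      _ ≤ ∑ _w : W, 2 * E * ∑ m, f m :=
          sum_le_sum_of_subset_of_nonneg (erase_subset _ _) fun _ _ _ => by positivity
      _ = _ := by rw [sum_const, card_univ, nsmul_eq_mul]
  rw [← add_sum_erase _ _ (mem_univ (0 : W))] at hexp
  have hmain : ∑ m, ∑ d, (f m : ℂ) * f (m + d) * f (m + 2 • d) *
      ZMod.stdAddChar ((0 : W).1 d) = (apCount f : ℂ) := by
    simp [apCount]
  rw [hmain] at hexp
  have hre := congrArg Complex.re hexp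
  rw [Complex.add_re, Complex.ofReal_re, Complex.ofReal_re] at hre
  have := (Complex.re_le_norm _).trans htail
  linarith

end Subspace

/-! ### The dot product and linear functionals -/

section Dot

variable {p n : ℕ} {K : Type*} [AddCommGroup K] [Module (ZMod p) K]

/-- The linear functional `x ↦ a · x`. -/
noncomputable def dotDual (b : Basis (Fin n) (ZMod p) K) (a : K) : Dual (ZMod p) K :=
  ∑ i, b.repr a i • b.coord i

lemma dotDual_apply (b : Basis (Fin n) (ZMod p) K) (a x : K) : dotDual b a x = dot b a x := by
  simp [dotDual, dot]

lemma dotDual_surjective (b : Basis (Fin n) (ZMod p) K) : Function.Surjective (dotDual b) := by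
  intro φ
  refine ⟨b.equivFun.symm fun i => φ (b i), b.ext fun i => ?_⟩
  rw [dotDual_apply, dot, sum_eq_single i]
  · rw [← b.equivFun_apply, LinearEquiv.apply_symm_apply]
    simp
  · intro k _ hk
    simp [Finsupp.single_apply, hk.symm]
  · simp

lemma fourierCoeff_eq_hat [Fact p.Prime] [Fintype K] (b : Basis (Fin n) (ZMod p) K) (f : K → ℝ)
    (a : K) : fourierCoeff b f a = hat (fun x => (f x : ℂ)) (dotDual b a) := by
  refine sum_congr rfl fun m _ => ?_
  rw [dotDual_apply]
  have := ZMod.stdAddChar_coe (N := p) ((dot b a m).val : ℤ)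
  rw [Int.cast_natCast, ZMod.natCast_zmod_val, Int.cast_natCast] at this
  rw [this]

/-- Off the frequencies `a 1, …, a j` all Fourier coefficients are at most the `j`-th one. -/
lemma exists_largeSpectrum [Fact p.Prime] [Fintype K] {b : Basis (Fin n) (ZMod p) K}
    {f : K → ℝ} {a : ℕ → K} (ha : IsFourierOrdering b f a) {j : ℕ} (hj1 : 1 ≤ j)
    (hj : j ≤ Fintype.card K) :
    ∃ S : Finset (Dual (ZMod p) K), #S ≤ j ∧
      ∀ φ ∉ S, ‖hat (fun x => (f x : ℂ)) φ‖ ≤ ‖fourierCoeff b f (a j)‖ := by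
  classical
  refine ⟨(Icc 1 j).image fun i => dotDual b (a i), card_image_le.trans (by simp), ?_⟩
  intro φ hφ
  obtain ⟨x, rfl⟩ := dotDual_surjective b φ
  obtain ⟨i, hi, rfl⟩ := ha.1.surjOn (Set.mem_univ x)
  rw [← fourierCoeff_eq_hat]
  refine ha.2 ⟨hj1, hj⟩ hi (le_of_not_gt fun hlt => hφ ?_)
  exact mem_image.2 ⟨i, mem_Icc.2 ⟨hi.1, hlt.le⟩, rfl⟩

end Dot

/-! ### Choice of parameters -/

/-- Few density increments suffice to reach density `1`, namely `k ≤ 9 y log (1/θ)`, and for such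
`k` the losses `P ^ k` are affordable. -/
lemma exists_step_count {θ N P y X : ℝ} (hθ0 : 0 < θ) (hθ : θ ≤ 3 / 4) (hP : 1 ≤ P) (hy : 1 ≤ y)
    (hX : y * (324 * Real.log P + 10) ≤ X) (hN0 : 0 < N) (hLX : -Real.log θ * X < 2 * Real.log N)
    (hLN : -Real.log θ < Real.log N / 9) (hN : 9 ≤ Real.log N) :
    ∃ k : ℕ, 1 < (1 + 1 / (4 * y)) ^ k * θ ∧ 4 * θ ^ X * P ^ k ≤ θ ^ 2 ∧
      2 * P ^ (2 * k) < θ ^ 2 * N := by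
  have hP0 : 0 < P := by linarith
  have hy0 : 0 < y := by linarith
  set L := -Real.log θ with hL
  set q := Real.log P with hq
  have hq0 : 0 ≤ q := Real.log_nonneg hP
  have hL4 : 1 / 4 ≤ L := by
    have := Real.log_le_sub_one_of_pos hθ0
    linarith
  have hθe : θ = Real.exp (-L) := by rw [hL, neg_neg, Real.exp_log hθ0]
  have hPe : P = Real.exp q := (Real.exp_log hP0).symm
  have hNe : N = Real.exp (Real.log N) := (Real.exp_log hN0).symm
  have hyL : 1 / 4 ≤ y * L := by nlinarith
  refine ⟨⌊5 * y * L⌋₊ + 1, ?_⟩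
  set k := ⌊5 * y * L⌋₊ + 1 with hk
  have hk1 : 5 * y * L < k := by
    rw [hk]; push_cast; exact Nat.lt_floor_add_one _
  have hk2 : (k : ℝ) ≤ 9 * (y * L) := by
    have : (⌊5 * y * L⌋₊ : ℝ) ≤ 5 * y * L := Nat.floor_le (by positivity)
    rw [hk]; push_cast; linarith
  have hkq : k * q ≤ 9 * (y * L) * q := by gcongr
  have h4 : (4 : ℝ) ≤ Real.exp 2 := by
    have := Real.add_one_le_exp (1 : ℝ)
    calc (4 : ℝ) = (1 + 1) ^ 2 := by norm_num
      _ ≤ Real.exp 1 ^ 2 := by gcongr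
      _ = Real.exp 2 := by rw [← Real.exp_nat_mul]; norm_num
  have h2 : (2 : ℝ) ≤ Real.exp 1 := by
    have := Real.add_one_le_exp (1 : ℝ)
    linarith
  have hXL : L * (y * (324 * q + 10)) ≤ L * X := by gcongr
  have hyL0 : L ≤ y * L := by nlinarith
  have hyLq : 0 ≤ y * L * q := by positivity
  refine ⟨?_, ?_, ?_⟩
  · have hu : 1 / (5 * y) ≤ Real.log (1 + 1 / (4 * y)) := by
      refine le_trans ?_ (Real.one_sub_inv_le_log_of_pos (by positivity))
      have : 1 - (1 + 1 / (4 * y))⁻¹ = 1 / (4 * y + 1) := by field_simp; ring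
      rw [this]
      exact one_div_le_one_div_of_le (by positivity) (by linarith)
    have h5 : L < k * Real.log (1 + 1 / (4 * y)) := by
      have : L < k * (1 / (5 * y)) := by
        rw [mul_one_div, lt_div_iff₀ (by positivity)]
        linarith
      exact this.trans_le (by gcongr)
    have h6 : (1 + 1 / (4 * y)) ^ k = Real.exp (k * Real.log (1 + 1 / (4 * y))) := by
      rw [Real.exp_nat_mul, Real.exp_log (by positivity)]
    rw [h6, hθe, ← Real.exp_add, Real.one_lt_exp_iff]
    linarith
  · rw [Real.rpow_def_of_pos hθ0, hPe, ← Real.exp_nat_mul]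
    have : θ ^ 2 = Real.exp (-(2 * L)) := by
      rw [hθe, ← Real.exp_nat_mul]; congr 1; push_cast; ring
    rw [this]
    calc _ ≤ Real.exp 2 * Real.exp (Real.log θ * X) * Real.exp (k * q) := by gcongr
      _ = Real.exp (2 + Real.log θ * X + k * q) := by rw [Real.exp_add, Real.exp_add]
      _ ≤ _ := by
        rw [Real.exp_le_exp]
        have : Real.log θ * X = -(L * X) := by rw [hL]; ring
        rw [this]
        linarith
  · have h7 : θ ^ 2 * N = Real.exp (-(2 * L) + Real.log N) := by
      rw [Real.exp_add, ← hNe, hθe, ← Real.exp_nat_mul]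
      congr 2; push_cast; ring
    -- `2 k q ≤ 18 y L q ≤ L X / 18 < log N / 9`, which is where the constant `324 = 18²` is used
    rw [h7, hPe, ← Real.exp_nat_mul]
    calc _ ≤ Real.exp 1 * Real.exp ((2 * k : ℕ) * q) := by gcongr
      _ = Real.exp (1 + (2 * k : ℕ) * q) := by rw [Real.exp_add]
      _ < _ := by
        rw [Real.exp_lt_exp]
        push_cast
        linarith

/-! ### The lower bound for the number of progressions -/

section LowerBound

variable {p : ℕ} [Fact p.Prime] {G : Type*} [AddCommGroup G] [Module (ZMod p) G] [Fintype G]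

/-- When the coefficients off `S` are at most `1 / |G|`, even the trivial progressions force many
progressions. -/
lemma lt_apCount_of_tiny_tail (hp2 : p ≠ 2) {f : G → ℝ} (hf : ∀ m, f m ∈ Set.Icc (0 : ℝ) 1)
    {S : Finset (Dual (ZMod p) G)} {j : ℕ} (hS : #S ≤ j)
    (hE : ∀ φ ∉ S, ‖hat (fun x => (f x : ℂ)) φ‖ ≤ (Fintype.card G : ℝ)⁻¹)
    {θ : ℝ} (hθ0 : 0 < θ) (hθ : ∑ m, f m = θ * Fintype.card G)
    (h : 3 + p * (j : ℝ) ^ 2 < θ ^ 2 * Fintype.card G) :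
    θ * Fintype.card G < apCount f := by
  classical
  obtain ⟨W, hW, hcard⟩ := exists_submodule_disjoint
    (D := ((S ×ˢ S).image fun x => x.1 - x.2).erase 0) (notMem_erase _ _)
  have hD : #(((S ×ˢ S).image fun x => x.1 - x.2).erase 0) ≤ j ^ 2 := by
    refine (card_erase_le.trans card_image_le).trans ?_
    rw [card_product, sq]
    exact Nat.mul_le_mul hS hS
  set N : ℝ := (Fintype.card G : ℝ) with hN
  have hN0 : 0 < N := Nat.cast_pos.2 Fintype.card_pos
  have hcount := card_mul_sum_cube_le hp2 hf (inv_nonneg.2 hN0.le) hE (W := W) (by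
    intro φ hφ χ hχ hmem
    by_contra hne
    refine hW _ hmem (mem_erase.2 ⟨sub_ne_zero.2 hne, ?_⟩)
    exact mem_image.2 ⟨(φ, χ), mem_product.2 ⟨hφ, hχ⟩, rfl⟩)
  have hW0 : (0 : ℝ) < Nat.card W := Nat.cast_pos.2 Nat.card_pos
  have hcardR : N ≤ Nat.card W * (1 + p * (j : ℝ) ^ 2) := by
    have h1 : Fintype.card G ≤ Nat.card W * (1 + p * j ^ 2) := hcard.trans (by gcongr)
    rw [hN]
    exact_mod_cast h1
  set w : ℝ := (Nat.card W : ℝ) with hw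
  have hcube := cube_sum_le hf
  rw [hθ] at hcube hcount
  have e1 : (θ * N) ^ 3 / N ^ 2 = θ ^ 3 * N := by field_simp
  have e2 : 2 * N⁻¹ * (θ * N) = 2 * θ := by field_simp
  rw [e1] at hcube
  rw [e2] at hcount
  have h2 := mul_le_mul_of_nonneg_left hcube hW0.le
  have h3 : N < w * (θ ^ 2 * N - 2) :=
    hcardR.trans_lt (mul_lt_mul_of_pos_left (by linarith) hW0)
  calc θ * N < θ * (w * (θ ^ 2 * N - 2)) := mul_lt_mul_of_pos_left h3 hθ0
    _ = w * (θ ^ 3 * N) - w * (2 * θ) := by ring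
    _ ≤ apCount f := by linarith

/-- When `j` is small enough for the iteration to finish before the space is exhausted, the density
increment argument applies. -/
lemma lt_apCount_of_increment (hp2 : p ≠ 2) {f : G → ℝ} (hf : ∀ m, f m ∈ Set.Icc (0 : ℝ) 1)
    {S : Finset (Dual (ZMod p) G)} {j : ℕ} (hj : 1 ≤ j) (hS : #S ≤ j) {θ X : ℝ} (hθ0 : 0 < θ)
    (hE : ∀ φ ∉ S, ‖hat (fun x => (f x : ℂ)) φ‖ ≤ θ ^ X * Fintype.card G)
    (hθ : ∑ m, f m = θ * Fintype.card G) (hθ34 : θ ≤ 3 / 4)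
    (hX : √j * (324 * Real.log p + 10) ≤ X)
    (hLX : -Real.log θ * X < 2 * Real.log (Fintype.card G))
    (hLN : -Real.log θ < Real.log (Fintype.card G) / 9) (hN9 : 9 ≤ Real.log (Fintype.card G)) :
    θ * Fintype.card G < apCount f := by
  have hp0 : (0 : ℝ) < p := Nat.cast_pos.2 (Fact.out : p.Prime).pos
  have hp1 : (1 : ℝ) ≤ p := Nat.one_le_cast.2 (Fact.out : p.Prime).one_le
  have hj1 : (1 : ℝ) ≤ j := Nat.one_le_cast.2 hj
  have hy : 1 ≤ √(j : ℝ) := Real.one_le_sqrt.2 hj1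
  have hy0 : 0 < √(j : ℝ) := by linarith
  have hN0 : (0 : ℝ) < Fintype.card G := Nat.cast_pos.2 Fintype.card_pos
  obtain ⟨k, hk1, hk2, hk3⟩ := exists_step_count hθ0 hθ34 hp1 hy hX hN0 hLX hLN hN9
  have hη : (j : ℝ) * (1 / (2 * √j)) ^ 3 ≤ 1 / 4 := by
    have : (j : ℝ) * (1 / (2 * √j)) ^ 3 = 1 / (8 * √j) := by
      have hsq : (j : ℝ) = √j ^ 2 := (Real.sq_sqrt (by positivity)).symm
      nth_rw 1 [hsq]
      field_simp
      norm_num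
    rw [this]
    exact one_div_le_one_div_of_le (by norm_num) (by linarith)
  have hη2 : 1 + 1 / (2 * √(j : ℝ)) / 2 = 1 + 1 / (4 * √(j : ℝ)) := by
    field_simp
    ring
  have main := cube_mul_sq_le_apCount hp2 hθ0 (η := 1 / (2 * √j)) (by positivity) hη
    (E := θ ^ X * Fintype.card G) (by positivity) k hf hS hE hθ.ge
    (by
      rw [hη2, hθ, ← mul_assoc]
      exact lt_mul_of_one_lt_left hN0 hk1)
    (by
      calc 4 * (θ ^ X * (Fintype.card G : ℝ)) * (p : ℝ) ^ k
          = 4 * θ ^ X * p ^ k * Fintype.card G := by ring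
        _ ≤ _ := by gcongr)
  set N : ℝ := (Fintype.card G : ℝ) with hN
  have hP : (0 : ℝ) < 2 * p ^ (2 * k) := by positivity
  refine lt_of_mul_lt_mul_left ?_ hP.le
  calc 2 * (p : ℝ) ^ (2 * k) * (θ * N) < θ ^ 2 * N * (θ * N) := by gcongr
    _ = θ ^ 3 * N ^ 2 := by ring
    _ ≤ _ := main

/-- The two regimes are separated by whether `θ ^ X` is above or below `|G|⁻²`. -/
lemma lt_apCount_of_decay {f : G → ℝ} (hf : ∀ m, f m ∈ Set.Icc (0 : ℝ) 1)
    {S : Finset (Dual (ZMod p) G)} {j : ℕ} (hj : 1 ≤ j) (hS : #S ≤ j) {θ X : ℝ}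
    (hE : ∀ φ ∉ S, ‖hat (fun x => (f x : ℂ)) φ‖ ≤ θ ^ X * Fintype.card G)
    (hθ : ∑ m, f m = θ * Fintype.card G)
    (hX : √j * (324 * Real.log p + 10) ≤ X)
    (hθN : (Fintype.card G : ℝ) ^ (-(1 / 9) : ℝ) < θ)
    (hjN : (j : ℝ) < (Fintype.card G : ℝ) ^ (1 / 8 : ℝ))
    (hN9 : 9 ≤ Real.log (Fintype.card G)) (hNp : ((p : ℝ) + 3) ^ 2 ≤ Fintype.card G) :
    θ * Fintype.card G < apCount f := by
  have hp0 : (0 : ℝ) < p := Nat.cast_pos.2 (Fact.out : p.Prime).pos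
  set N : ℝ := (Fintype.card G : ℝ) with hN
  have hN0 : 0 < N := Nat.cast_pos.2 Fintype.card_pos
  have hN1 : 9 ≤ N := by nlinarith
  have hθ0 : 0 < θ := (Real.rpow_pos_of_pos hN0 _).trans hθN
  have hθ2N : N ^ (7 / 9 : ℝ) < θ ^ 2 * N := by
    calc N ^ (7 / 9 : ℝ) = (N ^ (-(1 / 9) : ℝ)) ^ 2 * N := by
          rw [← Real.rpow_natCast, ← Real.rpow_mul hN0.le, ← Real.rpow_add_one hN0.ne']
          norm_num
      _ < _ := by
          have := (Real.rpow_pos_of_pos hN0 (-(1 / 9) : ℝ)).le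
          gcongr
  have hlow : 3 + p * (j : ℝ) ^ 2 < θ ^ 2 * N := by
    refine lt_of_le_of_lt ?_ hθ2N
    have h1 : (j : ℝ) ^ 2 ≤ N ^ (1 / 4 : ℝ) := by
      calc (j : ℝ) ^ 2 ≤ (N ^ (1 / 8 : ℝ)) ^ 2 := by gcongr
        _ = N ^ (1 / 4 : ℝ) := by
          rw [← Real.rpow_natCast, ← Real.rpow_mul hN0.le]; norm_num
    have h2 : (1 : ℝ) ≤ N ^ (1 / 4 : ℝ) := Real.one_le_rpow (by linarith) (by norm_num)
    have h3 : (p : ℝ) + 3 ≤ N ^ (1 / 2 : ℝ) := by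
      rw [← Real.sqrt_eq_rpow]
      exact Real.le_sqrt_of_sq_le hNp
    calc 3 + p * (j : ℝ) ^ 2 ≤ 3 * N ^ (1 / 4 : ℝ) + p * N ^ (1 / 4 : ℝ) := by
          gcongr; linarith
      _ = (p + 3) * N ^ (1 / 4 : ℝ) := by ring
      _ ≤ N ^ (1 / 2 : ℝ) * N ^ (1 / 4 : ℝ) := by gcongr
      _ = N ^ (3 / 4 : ℝ) := by rw [← Real.rpow_add hN0]; norm_num
      _ ≤ N ^ (7 / 9 : ℝ) := Real.rpow_le_rpow_of_exponent_le (by linarith) (by norm_num)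
  by_cases hp2 : p = 2
  · have h2 : ∀ d : G, 2 • d = 0 := by
      intro d
      have h1 : ((2 : ℕ) : ZMod p) = 0 := by
        rw [ZMod.natCast_eq_zero_iff, hp2]
      rw [← Nat.cast_smul_eq_nsmul (ZMod p), h1, zero_smul]
    have h1 := cube_sum_le_apCount_of_char_two h2 hf
    rw [hθ] at h1
    have e1 : (θ * N) ^ 3 / N = θ ^ 2 * N * (θ * N) := by field_simp
    refine lt_of_lt_of_le ?_ (e1 ▸ h1)
    have : 0 ≤ p * (j : ℝ) ^ 2 := by positivity
    exact lt_mul_of_one_lt_left (by positivity) (by linarith)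
  by_cases hθ34 : 3 / 4 ≤ θ
  · have h1 := dense_le_apCount hf
    rw [hθ] at h1
    have hθ1 : θ * N ≤ 1 * N := by
      rw [← hθ]
      have : ∑ m, f m ≤ ∑ _m : G, (1 : ℝ) := sum_le_sum fun m _ => (hf m).2
      simpa using this
    have h3 : N * (3 * (3 / 4 * N)) ≤ N * (3 * (θ * N)) := by gcongr
    change N * (3 * (θ * N)) - 2 * N ^ 2 ≤ _ at h1
    nlinarith
  have hθ34' : θ ≤ 3 / 4 := (not_le.1 hθ34).le
  by_cases hreg : -Real.log θ * X < 2 * Real.log N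
  · refine lt_apCount_of_increment hp2 hf hj hS hθ0 hE hθ hθ34' hX hreg ?_ hN9
    have := Real.log_lt_log (Real.rpow_pos_of_pos hN0 _) hθN
    rw [Real.log_rpow hN0] at this
    linarith
  · refine lt_apCount_of_tiny_tail hp2 hf hS (fun φ hφ => (hE φ hφ).trans ?_) hθ0 hθ hlow
    have h1 : θ ^ X ≤ (N ^ 2)⁻¹ := by
      rw [← Real.exp_log (pow_pos hN0 2), ← Real.exp_neg, Real.rpow_def_of_pos hθ0,
        Real.exp_le_exp, Real.log_pow]
      push_cast
      linarith
    calc θ ^ X * N ≤ (N ^ 2)⁻¹ * N := by gcongr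
      _ = N⁻¹ := by field_simp

end LowerBound
end CrootThreeAP

theorem mainTheorem1 (δ : ℝ) (hδ : 0 < δ) (p : ℕ) (hp : p.Prime) :
    ∃ J₀ N : ℕ, ∀ n : ℕ, N ≤ n →
      ∀ (K : Type*) [Field K] [Fintype K] [Algebra (ZMod p) K],
        Fintype.card K = p ^ n →
      ∀ (b : Module.Basis (Fin n) (ZMod p) K) (f : K → ℝ), (∀ m, f m ∈ Set.Icc (0 : ℝ) 1) →
      ∀ θ : ℝ, CrootThreeAP.mean f = θ →
        (Fintype.card K : ℝ) ^ (-(1 / 9) : ℝ) < θ →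
      ∀ a : ℕ → K, CrootThreeAP.IsFourierOrdering b f a →
      ∀ j : ℕ, J₀ < j → (j : ℝ) < (Fintype.card K : ℝ) ^ (1 / 8 : ℝ) →
        ‖CrootThreeAP.fourierCoeff b f (a j)‖
            < θ ^ ((j : ℝ) ^ (1 / 2 + δ : ℝ)) * (Fintype.card K : ℝ) →
        CrootThreeAP.Lam f > θ * (Fintype.card K : ℝ)⁻¹ ∧
          CrootThreeAP.HasNontrivialThreeAP (Function.support f) := by
  have : Fact p.Prime := ⟨hp⟩
  obtain ⟨J₀, hJ₀⟩ := Filter.eventually_atTop.1 <|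
    ((tendsto_rpow_atTop hδ).comp tendsto_natCast_atTop_atTop).eventually_ge_atTop
      (324 * Real.log p + 10)
  obtain ⟨N₁, hN₁⟩ := exists_nat_ge (Real.exp 9)
  refine ⟨J₀, max N₁ ((p + 3) ^ 2), ?_⟩
  intro n hn K _ _ _ hcard b f hf θ hmean hθN a ha j hj hjN hcoeff
  have hnK : n ≤ Fintype.card K := hcard ▸ (Nat.lt_pow_self hp.one_lt).le
  have hN0 : (0 : ℝ) < Fintype.card K := Nat.cast_pos.2 Fintype.card_pos
  have hN9 : 9 ≤ Real.log (Fintype.card K) := by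
    rw [Real.le_log_iff_exp_le hN0]
    exact hN₁.trans (Nat.cast_le.2 ((le_max_left _ _).trans (hn.trans hnK)))
  have hNp : ((p : ℝ) + 3) ^ 2 ≤ Fintype.card K := by
    exact_mod_cast (le_max_right _ _).trans (hn.trans hnK)
  have hN1 : (1 : ℝ) ≤ Fintype.card K := Nat.one_le_cast.2 Fintype.card_pos
  have hj1 : 1 ≤ j := by omega
  have hjK : j ≤ Fintype.card K := by
    have : (j : ℝ) ≤ Fintype.card K := hjN.le.trans
      ((Real.rpow_le_rpow_of_exponent_le hN1 (by norm_num)).trans_eq (Real.rpow_one _))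
    exact_mod_cast this
  have hsum : ∑ m, f m = θ * Fintype.card K := by
    rw [← hmean, CrootThreeAP.mean]
    field_simp
  obtain ⟨S, hS, hE⟩ := CrootThreeAP.exists_largeSpectrum ha hj1 hjK
  have hX : √(j : ℝ) * (324 * Real.log p + 10) ≤ (j : ℝ) ^ (1 / 2 + δ : ℝ) := by
    rw [Real.rpow_add (by exact_mod_cast hj1), ← Real.sqrt_eq_rpow]
    exact mul_le_mul_of_nonneg_left (hJ₀ j hj.le) (Real.sqrt_nonneg _)
  have hmain : θ * Fintype.card K < CrootThreeAP.apCount f :=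
    CrootThreeAP.lt_apCount_of_decay hf hj1 hS (fun φ hφ => (hE φ hφ).trans hcoeff.le) hsum hX hθN
      hjN hN9 hNp
  refine ⟨?_, CrootThreeAP.hasNontrivialThreeAP_of_sum_lt hf (hsum ▸ hmain)⟩
  rw [CrootThreeAP.Lam_eq, gt_iff_lt, lt_div_iff₀ (by positivity)]
  calc θ * (Fintype.card K : ℝ)⁻¹ * (Fintype.card K : ℝ) ^ 2 = θ * Fintype.card K := by field_simp
    _ < _ := hmain
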